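/- For $n\ge 1$ let $\mathcal P_n=\{g^n : g\in\mathbb Z[[x]],\ g(0)=1\}$. The theta series of an integral lattice $\Lambda$ in a Euclidean space is $\Theta_\Lambda(x)=\sum_{u\in\Lambda}x^{u\cdot u}\in\mathbb Z[[x]]$. For $m\ge 1$ let $BW_{2^m}\subset\mathbb R^{2^m}$ be the Barnes–Wall lattice, normalized to have minimal norm $\min_{0\ne u} u\cdot u=2^{m-1}$; that is, with the coordinates of $\mathbb R^{2^m}$ indexed by the points of $\mathbb F_2^m$, $BW_{2^m}$ is the $\mathbb Z$-span of the vectors $2^{\lfloor (m-d)/2\rfloor}\chi_F$, where $0\le d\le m$, $F$ runs through the $d$-dimensional affine subspaces of $\mathbb F_2^m$, and $\chi_F$ is the indicator vector of $F$. (So $BW_2=\mathbb Z^2$, $BW_4=D_4$, $BW_8\cong\sqrt2\,E_8$.) Congruences between power series are coefficientwise. Theorem. For every $m\ge 1$, $\Theta_{BW_{2^m}}(x)\equiv 1\pmod{2^{m+1}}$, and $\Theta_{BW_{2^m}}(x)\in\mathcal P_{2^m}$. More precisely, for every $m\ge 2$ the series $\dfrac{\Theta_{BW_{2^m}}(x)-1}{2^{m+1}}$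 and $\dfrac{\Theta_{BW_{2^{m-1}}}(x^2)-1}{2^m}$ have integer coefficients, and $$\frac{\Theta_{BW_{2^m}}(x)-1}{2^{m+1}}\equiv(1-2^{m-1})\,\frac{\Theta_{BW_{2^{m-1}}}(x^2)-1}{2^m}\pmod{2^m}.$$ -/

import Mathlib

open scoped PowerSeries

noncomputable section

/-- The set `𝓟ₙ` of `n`-th powers of integral power series with constant term `1`. -/
def nthPowers (n : ℕ) : Set ℤ⟦X⟧ :=
  {f | ∃ g : ℤ⟦X⟧, PowerSeries.constantCoeff g = 1 ∧ f = g ^ n}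

/-- Coefficientwise congruence of integral power series modulo `N`. -/
def CongrMod (N : ℤ) (f g : ℤ⟦X⟧) : Prop :=
  ∀ k : ℕ, PowerSeries.coeff k f ≡ PowerSeries.coeff k g [ZMOD N]

/-- The theta series `∑_{u ∈ L} x ^ (u · u)` of an integral lattice `L`: the coefficient of `x ^ k`
is the number of `u ∈ L` with `u · u = k`. -/
def thetaSeries {E : Type*} [NormedAddCommGroup E] [InnerProductSpace ℝ E]
    (L : Submodule ℤ E) : ℤ⟦X⟧ :=
  PowerSeries.mk fun k => (Nat.card {u : E // u ∈ L ∧ inner ℝ u u = (k : ℝ)} : ℤ)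

open Classical in
/-- The indicator vector in `ℝ ^ (2 ^ m)`, with coordinates indexed by the points of `𝔽₂ ^ m`, of
the affine subspace (flat) `v + W`. -/
def flatVector {m : ℕ} (W : Submodule (ZMod 2) (Fin m → ZMod 2)) (v : Fin m → ZMod 2) :
    EuclideanSpace ℝ (Fin m → ZMod 2) :=
  WithLp.toLp 2 fun x => if x - v ∈ W then 1 else 0

/-- The Barnes–Wall lattice in `ℝ ^ (2 ^ m)`, normalized to have minimal norm `2 ^ (m - 1)`
for `m ≥ 1`:
the integral span of the vectors `2 ^ ⌊(m - d) / 2⌋ χ_F`, where `F` runs through the `d`-dimensional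
flats of `𝔽₂ ^ m` for `0 ≤ d ≤ m`, and `χ_F` is the indicator vector of `F`. -/
def barnesWall (m : ℕ) : Submodule ℤ (EuclideanSpace ℝ (Fin m → ZMod 2)) :=
  Submodule.span ℤ (Set.range fun p : Submodule (ZMod 2) (Fin m → ZMod 2) × (Fin m → ZMod 2) =>
    (2 : ℝ) ^ ((m - Module.finrank (ZMod 2) p.1) / 2) • flatVector p.1 p.2)

theorem barnesWall_coord {m : ℕ} {u : EuclideanSpace ℝ (Fin m → ZMod 2)} (hu : u ∈ barnesWall m) :
    ∃ z : (Fin m → ZMod 2) → ℤ, ∀ x, u x = (z x : ℝ) := by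
  refine Submodule.span_induction (p := fun u _ => ∃ z : (Fin m → ZMod 2) → ℤ, ∀ x, u x = (z x : ℝ))
    ?_ ?_ ?_ ?_ hu
  · rintro _ ⟨p, rfl⟩
    classical
    refine ⟨fun x => 2 ^ ((m - Module.finrank (ZMod 2) p.1) / 2) *
      if x - p.2 ∈ p.1 then 1 else 0, fun x => ?_⟩
    simp [flatVector]
  · exact ⟨0, by simp⟩
  · rintro _ _ _ _ ⟨a, ha⟩ ⟨b, hb⟩
    exact ⟨a + b, fun x => by simp [ha, hb]⟩
  · rintro c _ _ ⟨a, ha⟩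
    exact ⟨c • a, fun x => by simp [ha]⟩

/-- All inner products of vectors of the Barnes–Wall lattice are integers. -/
theorem barnesWall_integral {m : ℕ} {u v : EuclideanSpace ℝ (Fin m → ZMod 2)}
    (hu : u ∈ barnesWall m) (hv : v ∈ barnesWall m) : ∃ z : ℤ, inner ℝ u v = (z : ℝ) := by
  obtain ⟨a, ha⟩ := barnesWall_coord hu
  obtain ⟨b, hb⟩ := barnesWall_coord hv
  refine ⟨∑ x, b x * a x, ?_⟩
  simp [PiLp.inner_apply, ha, hb]

/-- There are only finitely many vectors of each norm in the Barnes–Wall lattice, so the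
coefficients of its theta series are true cardinalities. -/
theorem barnesWall_finite (m k : ℕ) :
    Finite {u : EuclideanSpace ℝ (Fin m → ZMod 2) //
      u ∈ barnesWall m ∧ inner ℝ u u = (k : ℝ)} := by
  choose z hz using fun u : {u : EuclideanSpace ℝ (Fin m → ZMod 2) //
    u ∈ barnesWall m ∧ inner ℝ u u = (k : ℝ)} => barnesWall_coord u.2.1
  have hb : ∀ u x, z u x ∈ Set.Icc (-(k : ℤ)) k := by
    intro u x
    have h1 : ∑ x, (z u x) ^ 2 = (k : ℤ) := by
      have := u.2.2
      rw [PiLp.inner_apply] at this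
      have h2 : ((∑ x, (z u x) ^ 2 : ℤ) : ℝ) = k := by
        rw [← this]; push_cast
        exact Finset.sum_congr rfl fun x _ => by simp [hz u x]
      exact_mod_cast h2
    have h3 : (z u x) ^ 2 ≤ k := h1 ▸
      Finset.single_le_sum (f := fun x => (z u x) ^ 2) (fun _ _ => sq_nonneg _) (Finset.mem_univ x)
    constructor <;> nlinarith [Int.le_self_sq (z u x), Int.le_self_sq (-(z u x))]
  refine Finite.of_injective
    (fun u (x : Fin m → ZMod 2) => (⟨z u x, hb u x⟩ : Set.Icc (-(k : ℤ)) k)) ?_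
  intro u v h
  ext x
  have := congrArg Subtype.val (congrFun h x)
  rw [hz u x, hz v x]
  exact_mod_cast this

end

/-! The extraspecial group of order `2 ^ (2m+1)`, generated by translations and sign changes `(-1) ^
(b x)`, acts on the vectors of each norm `k ≠ 0` of the lattice. By Burnside the numbers of fixed
vectors sum to a multiple of the group order. The identity fixes all `N_m(k)` vectors; `-1` and the
elements of order 4, whose square is `-1`, fix none. For `m ≥ 2` each of the `(2^m - 1)(2^m + 2)`
noncentral involutions fixes as many vectors as a translation does. Those are the periodic vectors,
a copy of the lattice of rank `2 ^ (m-1)` with norms doubled. Hence `N_m(k) + (2^m - 1)(2^m + 2)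
N_{m-1}(k/2) ≡ 0 mod 2^(2m+1)` (`shellCount_modEq`), with `N_{m-1}(k/2)` read as 0 for odd `k`.
Induction on `m` gives `2^(m+1) ∣ N_m(k)`, and dividing by `2^(m+1)` gives the refined congruence.
Membership in `𝓟` needs only the first congruence: a series with constant term 1 that is 1 mod
`2^(m+1)` has `m` successive integral square roots (`one_add_mem_nthPowers`). -/

/-! ### The lattices `bwLattice V s` and the operators relating them. -/

section Lattice

variable {U V : Type*} [AddCommGroup U] [Module (ZMod 2) U] [AddCommGroup V] [Module (ZMod 2) V]

theorem zmod_two_eq_zero_or_one (z : ZMod 2) : z = 0 ∨ z = 1 := by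
  revert z; decide

open Classical in
/-- The integral indicator function of the flat `v + W`. -/
noncomputable def flatIndicator (W : Submodule (ZMod 2) V) (v : V) : V → ℤ :=
  fun x => if x - v ∈ W then 1 else 0

theorem flatIndicator_of_mem {W : Submodule (ZMod 2) V} {v x : V} (h : x - v ∈ W) :
    flatIndicator W v x = 1 := if_pos h

theorem flatIndicator_of_notMem {W : Submodule (ZMod 2) V} {v x : V} (h : x - v ∉ W) :
    flatIndicator W v x = 0 := if_neg h

theorem flatIndicator_congr {W : Submodule (ZMod 2) V} {v x : V} {W' : Submodule (ZMod 2) U}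
    {v' x' : U} (h : x - v ∈ W ↔ x' - v' ∈ W') : flatIndicator W v x = flatIndicator W' v' x' := by
  by_cases h1 : x - v ∈ W
  · rw [flatIndicator_of_mem h1, flatIndicator_of_mem (h.1 h1)]
  · rw [flatIndicator_of_notMem h1, flatIndicator_of_notMem (h.not.1 h1)]

/-- The lattice spanned by the `2 ^ k χ_F` with `s ≤ 2 k + dim F + 1`. For `s = dim V` this is the
Barnes–Wall lattice, for `s = dim V + 1` it is a rotated and rescaled copy. -/
def bwLattice (V : Type*) [AddCommGroup V] [Module (ZMod 2) V] (s : ℤ) : Submodule ℤ (V → ℤ) :=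
  Submodule.span ℤ {f | ∃ (k : ℕ) (W : Submodule (ZMod 2) V) (v : V),
    s ≤ 2 * k + Module.finrank (ZMod 2) W + 1 ∧ f = (2 ^ k : ℤ) • flatIndicator W v}

theorem smul_flatIndicator_mem {s : ℤ} {k : ℕ} {W : Submodule (ZMod 2) V} (v : V)
    (h : s ≤ 2 * k + Module.finrank (ZMod 2) W + 1) :
    (2 ^ k : ℤ) • flatIndicator W v ∈ bwLattice V s :=
  Submodule.subset_span ⟨k, W, v, h, rfl⟩

theorem bwLattice_map_mem {s t : ℤ} (T : (V → ℤ) →ₗ[ℤ] (U → ℤ))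
    (h : ∀ (k : ℕ) (W : Submodule (ZMod 2) V) (v : V),
      s ≤ 2 * k + Module.finrank (ZMod 2) W + 1 →
        (2 ^ k : ℤ) • T (flatIndicator W v) ∈ bwLattice U t)
    {u : V → ℤ} (hu : u ∈ bwLattice V s) : T u ∈ bwLattice U t := by
  have : bwLattice V s ≤ (bwLattice U t).comap T := by
    refine Submodule.span_le.2 ?_
    rintro _ ⟨k, W, v, hk, rfl⟩
    simpa only [SetLike.mem_coe, Submodule.mem_comap, map_smul] using h k W v hk
  exact this hu

theorem two_smul_mem_bwLattice {s : ℤ} {u : V → ℤ} (hu : u ∈ bwLattice V s) :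
    (2 : ℤ) • u ∈ bwLattice V (s + 2) := by
  refine bwLattice_map_mem (s := s) ((2 : ℤ) • LinearMap.id) (fun k W v hk => ?_) hu
  have := smul_flatIndicator_mem (s := s + 2) (k := k + 1) (W := W) v (by push_cast; lia)
  rwa [pow_succ, mul_smul] at this

theorem finrank_add_finrank_le_comap [Finite U] [Finite V] (f : U →ₗ[ZMod 2] V)
    (W : Submodule (ZMod 2) V) :
    Module.finrank (ZMod 2) U + Module.finrank (ZMod 2) W ≤
      Module.finrank (ZMod 2) V + Module.finrank (ZMod 2) (W.comap f) := by
  have h1 := LinearMap.finrank_range_add_finrank_ker (W.mkQ ∘ₗ f)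
  have h2 := Submodule.finrank_le (LinearMap.range (W.mkQ ∘ₗ f))
  have h3 := Submodule.finrank_quotient_add_finrank W
  have h4 : LinearMap.ker (W.mkQ ∘ₗ f) = W.comap f := by
    rw [LinearMap.ker_comp, Submodule.ker_mkQ]
  rw [h4] at h1
  lia

/-- Pulling back along a linear map preserves the lattices. -/
theorem comp_mem_bwLattice [Finite U] [Finite V] (f : U →ₗ[ZMod 2] V) {s t : ℤ}
    (hst : t + Module.finrank (ZMod 2) V ≤ s + Module.finrank (ZMod 2) U)
    {u : V → ℤ} (hu : u ∈ bwLattice V s) : u ∘ f ∈ bwLattice U t := by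
  refine bwLattice_map_mem (LinearMap.funLeft ℤ ℤ f) (fun k W v hk => ?_) hu
  by_cases hv : ∃ y, f y - v ∈ W
  · obtain ⟨y, hy⟩ := hv
    have : LinearMap.funLeft ℤ ℤ f (flatIndicator W v) = flatIndicator (W.comap f) y := by
      ext x
      refine flatIndicator_congr ?_
      rw [← Submodule.sub_mem_iff_left W hy]
      simp
    rw [this]
    refine smul_flatIndicator_mem _ ?_
    have := finrank_add_finrank_le_comap f W
    lia
  · have : LinearMap.funLeft ℤ ℤ f (flatIndicator W v) = 0 := by
      ext x
      exact flatIndicator_of_notMem fun h => hv ⟨x, h⟩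
    simp [this]

theorem translate_mem_bwLattice {s : ℤ} {u : V → ℤ} (a : V) (hu : u ∈ bwLattice V s) :
    (fun x => u (x + a)) ∈ bwLattice V s := by
  refine bwLattice_map_mem (LinearMap.funLeft ℤ ℤ (· + a)) (fun k W v hk => ?_) hu
  have : LinearMap.funLeft ℤ ℤ (· + a) (flatIndicator W v) = flatIndicator W (v - a) := by
    ext x
    refine flatIndicator_congr ?_
    rw [show x + a - v = x - (v - a) by abel]
  rw [this]
  exact smul_flatIndicator_mem _ hk

theorem finrank_le_inf_ker [Finite V] (W : Submodule (ZMod 2) V) (l : Module.Dual (ZMod 2) V) :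
    Module.finrank (ZMod 2) W ≤
      Module.finrank (ZMod 2) (W ⊓ LinearMap.ker l : Submodule (ZMod 2) V) + 1 := by
  have h1 := Submodule.finrank_sup_add_finrank_inf_eq W (LinearMap.ker l)
  have h2 := Submodule.finrank_le (W ⊔ LinearMap.ker l)
  have h3 := LinearMap.finrank_range_add_finrank_ker l
  have h4 := Submodule.finrank_le (LinearMap.range l)
  rw [Module.finrank_self] at h4
  lia

/-- Multiplication by the indicator function of an affine hyperplane. -/
theorem ite_mem_bwLattice [Finite V] {s : ℤ} {u : V → ℤ} (l : Module.Dual (ZMod 2) V)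
    (c : ZMod 2) (hu : u ∈ bwLattice V s) :
    (fun x => if l x = c then u x else 0) ∈ bwLattice V (s - 1) := by
  have key := bwLattice_map_mem (s := s) (t := s - 1)
    (LinearMap.mulLeft ℤ (fun x : V => if l x = c then (1 : ℤ) else 0)) (fun k W v hk => ?_) hu
  · convert key using 1
    ext x
    simp
  by_cases hv : ∃ y, y - v ∈ W ∧ l y = c
  · obtain ⟨y, hy, rfl⟩ := hv
    have : LinearMap.mulLeft ℤ (fun x : V => if l x = l y then (1 : ℤ) else 0)
        (flatIndicator W v) = flatIndicator (W ⊓ LinearMap.ker l) y := by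
      ext x
      have h1 : x - v ∈ W ↔ x - y ∈ W := by
        rw [← Submodule.sub_mem_iff_left W hy]; simp
      by_cases h2 : l x = l y
      · simpa [h2] using flatIndicator_congr (by simp [h1, h2])
      · simpa [h2] using (flatIndicator_of_notMem (by simp [h2, sub_eq_zero])).symm
    rw [this]
    refine smul_flatIndicator_mem _ ?_
    have := finrank_le_inf_ker W l
    lia
  · have : LinearMap.mulLeft ℤ (fun x : V => if l x = c then (1 : ℤ) else 0)
        (flatIndicator W v) = 0 := by
      ext x
      by_cases h1 : x - v ∈ W
      · have : l x ≠ c := fun h => hv ⟨x, h1, h⟩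
        simp [this]
      · simp [flatIndicator_of_notMem h1]
    simp [this]

/-- The nontrivial additive character of `𝔽₂`. -/
def sgn (z : ZMod 2) : ℤ := if z = 0 then 1 else -1

@[simp] theorem sgn_zero : sgn 0 = 1 := rfl

@[simp] theorem sgn_one : sgn 1 = -1 := rfl

theorem sgn_add (y z : ZMod 2) : sgn (y + z) = sgn y * sgn z := by
  revert y z; decide

@[simp] theorem sgn_mul_self (z : ZMod 2) : sgn z * sgn z = 1 := by
  revert z; decide

@[simp] theorem sgn_sq (z : ZMod 2) : sgn z ^ 2 = 1 := by
  revert z; decide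

/-- The sign is `1 - 2 [l = 1][b = 1 + c]`: two hyperplane restrictions lower `s` by 2, and the
factor 2 restores it. -/
theorem sgn_quadratic_mul_mem_bwLattice [Finite V] {s : ℤ} {u : V → ℤ}
    (l b : Module.Dual (ZMod 2) V) (c : ZMod 2) (hu : u ∈ bwLattice V s) :
    (fun x => sgn (l x * (b x + c)) * u x) ∈ bwLattice V s := by
  have h := two_smul_mem_bwLattice (ite_mem_bwLattice b (1 + c) (ite_mem_bwLattice l 1 hu))
  rw [show s - 1 - 1 + 2 = s by ring] at h
  convert Submodule.sub_mem _ hu h using 1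
  ext x
  simp only [Pi.sub_apply, Pi.smul_apply, smul_eq_mul]
  rcases zmod_two_eq_zero_or_one (l x) with h1 | h1 <;>
    rcases zmod_two_eq_zero_or_one (b x) with h2 | h2 <;>
    rcases zmod_two_eq_zero_or_one c with rfl | rfl <;>
    simp only [h1, h2] <;> simp [show (1 : ZMod 2) + 1 = 0 from rfl] <;> ring

/-- The similarity `S + T` of norm `2`, where `S` is the sign change by `l` and `T` is the
translation by `e`. -/
def hadamard (l : Module.Dual (ZMod 2) V) (e : V) (u : V → ℤ) : V → ℤ :=
  fun x => sgn (l x) * u x + u (x + e)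

theorem add_self_eq_zero_of_zmod_two (a : V) : a + a = 0 := by
  have : ((1 : ZMod 2) + 1) • a = 0 := by rw [show (1 : ZMod 2) + 1 = 0 from rfl, zero_smul]
  simpa [add_smul] using this

theorem add_add_self_of_zmod_two (x a : V) : x + a + a = x := by
  rw [add_assoc, add_self_eq_zero_of_zmod_two, add_zero]

/-- `S` and `T` are involutions that anticommute when `l e = 1`, so `(S + T)² = 2`. -/
theorem hadamard_hadamard {l : Module.Dual (ZMod 2) V} {e : V} (h : l e = 1) (u : V → ℤ) :
    hadamard l e (hadamard l e u) = (2 : ℤ) • u := by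
  ext x
  simp only [hadamard, map_add, h, sgn_add, sgn_one, add_add_self_of_zmod_two, Pi.smul_apply,
    smul_eq_mul]
  linear_combination u x * sgn_mul_self (l x)

theorem hadamard_two_smul (l : Module.Dual (ZMod 2) V) (e : V) (u : V → ℤ) :
    hadamard l e ((2 : ℤ) • u) = (2 : ℤ) • hadamard l e u := by
  ext x
  simp only [hadamard, Pi.smul_apply, smul_eq_mul]
  ring

theorem two_smul_ediv {α : Type*} (w : α → ℤ) : (fun x => ((2 : ℤ) • w) x / 2) = w := by
  ext x
  simp

theorem hadamard_mem_bwLattice [Finite V] {s : ℤ} {u : V → ℤ} (l : Module.Dual (ZMod 2) V)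
    (e : V) (hu : u ∈ bwLattice V s) : hadamard l e u ∈ bwLattice V (s + 1) := by
  let T : (V → ℤ) →ₗ[ℤ] (V → ℤ) :=
    LinearMap.mulLeft ℤ (fun x => sgn (l x)) + LinearMap.funLeft ℤ ℤ (· + e)
  refine bwLattice_map_mem T (fun k W v hk => ?_) hu
  have hmem := smul_flatIndicator_mem v hk
  -- If `e ∈ W`, translation fixes the flat and `S + T` is twice the restriction to `l = 0`.
  -- Otherwise the flat and its translate join into a flat of one dimension more, and the signs
  -- subtract twice the restriction to `l = 1`.
  by_cases he : e ∈ W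
  · have := two_smul_mem_bwLattice (ite_mem_bwLattice l 0 hmem)
    rw [show s - 1 + 2 = s + 1 by ring] at this
    convert this using 1
    ext x
    have hx : x + e - v ∈ W ↔ x - v ∈ W := by
      rw [show x + e - v = (x - v) + e by abel]; exact Submodule.add_mem_iff_left W he
    simp only [T, LinearMap.add_apply, LinearMap.mulLeft_apply, Pi.smul_apply, Pi.add_apply,
      Pi.mul_apply, LinearMap.funLeft_apply, flatIndicator_congr hx, smul_eq_mul]
    rcases zmod_two_eq_zero_or_one (l x) with hl | hl
    · simp [hl]; ring
    · simp [hl]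
  · have h1 := two_smul_mem_bwLattice (ite_mem_bwLattice l 1 hmem)
    rw [show s - 1 + 2 = s + 1 by ring] at h1
    have hdim : Module.finrank (ZMod 2) (W ⊔ Submodule.span (ZMod 2) {e} : Submodule _ V) =
        Module.finrank (ZMod 2) W + 1 := by
      have h2 := Submodule.finrank_sup_add_finrank_inf_eq W (Submodule.span (ZMod 2) {e})
      have h0 : e ≠ 0 := fun h => he (h ▸ W.zero_mem)
      have h3 : W ⊓ Submodule.span (ZMod 2) {e} = ⊥ := by
        rw [← disjoint_iff]
        exact (Submodule.disjoint_span_singleton' h0).2 he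
      rw [h3, finrank_bot, finrank_span_singleton h0] at h2
      lia
    have h2 : (2 ^ k : ℤ) • flatIndicator (W ⊔ Submodule.span (ZMod 2) {e}) v ∈
        bwLattice V (s + 1) := smul_flatIndicator_mem v (by rw [hdim]; push_cast; lia)
    convert Submodule.sub_mem _ h2 h1 using 1
    ext x
    have hx : x - v ∈ W ⊔ Submodule.span (ZMod 2) {e} ↔ x - v ∈ W ∨ x + e - v ∈ W := by
      rw [Submodule.mem_sup]
      constructor
      · rintro ⟨y, hy, z, hz, hyz⟩
        obtain ⟨c, rfl⟩ := Submodule.mem_span_singleton.1 hz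
        rcases zmod_two_eq_zero_or_one c with rfl | rfl
        · left; simpa [← hyz] using hy
        · right
          rw [show x + e - v = (x - v) + e by abel, ← hyz, one_smul, add_add_self_of_zmod_two]
          exact hy
      · rintro (hy | hy)
        · exact ⟨_, hy, 0, Submodule.zero_mem _, by simp⟩
        · refine ⟨_, hy, e, Submodule.mem_span_singleton_self e, ?_⟩
          rw [show x + e - v + e = (x - v) + e + e by abel, add_add_self_of_zmod_two]
    have hnot : ¬ (x - v ∈ W ∧ x + e - v ∈ W) := by
      rintro ⟨h3, h4⟩
      apply he
      simpa using W.sub_mem h4 h3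
    have hsup : flatIndicator (W ⊔ Submodule.span (ZMod 2) {e}) v x =
        flatIndicator W v x + flatIndicator W v (x + e) := by
      by_cases h3 : x - v ∈ W
      · rw [flatIndicator_of_mem (hx.2 (Or.inl h3)), flatIndicator_of_mem h3,
          flatIndicator_of_notMem fun h4 => hnot ⟨h3, h4⟩, add_zero]
      · rw [flatIndicator_of_notMem h3, zero_add]
        exact flatIndicator_congr (by rw [hx, or_iff_right h3])
    simp only [T, LinearMap.add_apply, LinearMap.mulLeft_apply, Pi.smul_apply, Pi.add_apply,
      Pi.mul_apply, Pi.sub_apply, LinearMap.funLeft_apply, hsup, smul_eq_mul]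
    rcases zmod_two_eq_zero_or_one (l x) with hl | hl
    · simp [hl]
    · simp [hl]; ring

/-- Since `dim W ≤ s`, every generator of level `s + 2` has exponent `k ≥ 1`, so a factor 2 comes
out. -/
theorem exists_two_smul_of_mem_bwLattice [Finite V] {s : ℤ} (hs : Module.finrank (ZMod 2) V ≤ s)
    {u : V → ℤ} (hu : u ∈ bwLattice V (s + 2)) : ∃ w ∈ bwLattice V s, u = (2 : ℤ) • w := by
  have : bwLattice V (s + 2) ≤ (bwLattice V s).map ((2 : ℤ) • LinearMap.id) := by
    refine Submodule.span_le.2 ?_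
    rintro _ ⟨k, W, v, hk, rfl⟩
    have := Submodule.finrank_le W
    obtain _ | k := k
    · push_cast at hk; lia
    · refine ⟨(2 ^ k : ℤ) • flatIndicator W v, smul_flatIndicator_mem v ?_, ?_⟩
      · push_cast at hk; lia
      · simp [pow_succ', mul_smul]
  obtain ⟨w, hw, rfl⟩ := this hu
  exact ⟨w, hw, rfl⟩

end Lattice

/-! ### The extraspecial group acting on shells, and its fixed-point counts. -/

section Shell

variable {U V : Type*} [AddCommGroup U] [Module (ZMod 2) U] [AddCommGroup V] [Module (ZMod 2) V]

/-- The vectors of norm `k` in the Barnes–Wall lattice of integral functions on `V`. -/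
def shell (V : Type*) [AddCommGroup V] [Module (ZMod 2) V] [Fintype V] (k : ℕ) : Set (V → ℤ) :=
  {u | u ∈ bwLattice V (Module.finrank (ZMod 2) V) ∧ ∑ x, u x ^ 2 = k}

/-- The extraspecial group `2 ^ (1 + 2 m)` as a set of triples `(s, a, b)`, acting on functions on
`V` by `u ↦ (-1) ^ (s + b x) u (x + a)`. -/
@[ext]
structure Extraspecial (V : Type*) [AddCommGroup V] [Module (ZMod 2) V] where
  s : ZMod 2
  a : V
  b : Module.Dual (ZMod 2) V

namespace Extraspecial

instance : Mul (Extraspecial V) := ⟨fun g h => ⟨g.s + h.s + h.b g.a, g.a + h.a, g.b + h.b⟩⟩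

instance : One (Extraspecial V) := ⟨⟨0, 0, 0⟩⟩

instance : Inv (Extraspecial V) := ⟨fun g => ⟨g.s + g.b g.a, g.a, g.b⟩⟩

theorem mul_def (g h : Extraspecial V) :
    g * h = ⟨g.s + h.s + h.b g.a, g.a + h.a, g.b + h.b⟩ := rfl

theorem one_def : (1 : Extraspecial V) = ⟨0, 0, 0⟩ := rfl

theorem inv_def (g : Extraspecial V) : g⁻¹ = ⟨g.s + g.b g.a, g.a, g.b⟩ := rfl

instance : Group (Extraspecial V) := Group.ofLeftAxioms
  (fun g h k => by
    ext1 <;> simp only [mul_def, map_add, LinearMap.add_apply] <;> abel)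
  (fun g => by simp [mul_def, one_def])
  (fun g => by
    ext1
    · simp only [mul_def, inv_def, one_def]
      generalize g.s = y, g.b g.a = z
      revert y z; decide
    · exact add_self_eq_zero_of_zmod_two _
    · exact add_self_eq_zero_of_zmod_two _)

/-- The components of an element. -/
def equivProd : Extraspecial V ≃ ZMod 2 × V × Module.Dual (ZMod 2) V where
  toFun g := (g.s, g.a, g.b)
  invFun p := ⟨p.1, p.2.1, p.2.2⟩

end Extraspecial

variable [Fintype U] [Fintype V]

theorem shell_finite (k : ℕ) : (shell V k).Finite := by
  classical
  refine (Set.finite_Icc (fun _ : V => -(k : ℤ)) (fun _ => (k : ℤ))).subset ?_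
  rintro u ⟨-, hu⟩
  have h (x : V) : u x ^ 2 ≤ k := hu ▸
    Finset.single_le_sum (f := fun x => u x ^ 2) (fun _ _ => sq_nonneg _) (Finset.mem_univ x)
  constructor <;> intro x <;> simp only <;>
    nlinarith [Int.le_self_sq (u x), Int.le_self_sq (-(u x)), h x]

instance shell.instFinite (k : ℕ) : Finite (shell V k) := shell_finite k

theorem ne_zero_of_mem_shell {k : ℕ} (hk : k ≠ 0) {u : V → ℤ} (hu : u ∈ shell V k) : u ≠ 0 := by
  rintro rfl
  simpa [hk, eq_comm] using hu.2

theorem translate_mem_shell {k : ℕ} {u : V → ℤ} (a : V) (hu : u ∈ shell V k) :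
    (fun x => u (x + a)) ∈ shell V k :=
  ⟨translate_mem_bwLattice a hu.1, by
    rw [← hu.2]; exact Equiv.sum_comp (Equiv.addRight a) fun x => u x ^ 2⟩

theorem sgn_quadratic_mul_mem_shell {k : ℕ} {u : V → ℤ} (l b : Module.Dual (ZMod 2) V)
    (c : ZMod 2) (hu : u ∈ shell V k) : (fun x => sgn (l x * (b x + c)) * u x) ∈ shell V k :=
  ⟨sgn_quadratic_mul_mem_bwLattice l b c hu.1, by simp [mul_pow, hu.2]⟩

theorem neg_mem_shell {k : ℕ} {u : V → ℤ} (hu : u ∈ shell V k) : -u ∈ shell V k :=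
  ⟨Submodule.neg_mem _ hu.1, by simp [hu.2]⟩

theorem sgn_mul_mem_shell {k : ℕ} {u : V → ℤ} (b : Module.Dual (ZMod 2) V) (c : ZMod 2)
    (hu : u ∈ shell V k) : (fun x => sgn (c + b x) * u x) ∈ shell V k := by
  have h : (fun x => sgn (b x) * u x) ∈ shell V k := by
    simpa using sgn_quadratic_mul_mem_shell b 0 1 hu
  rcases zmod_two_eq_zero_or_one c with rfl | rfl
  · simpa using h
  · convert neg_mem_shell h using 1
    ext x
    simp [sgn_add]

theorem sum_hadamard_sq {l : Module.Dual (ZMod 2) V} {e : V} (h : l e = 1) (u : V → ℤ) :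
    ∑ x, hadamard l e u x ^ 2 = 2 * ∑ x, u x ^ 2 := by
  have h1 : ∑ x, u (x + e) ^ 2 = ∑ x, u x ^ 2 := Equiv.sum_comp (Equiv.addRight e) fun x => u x ^ 2
  have h2 : ∑ x, sgn (l x) * u x * u (x + e) = -∑ x, sgn (l x) * u x * u (x + e) := by
    rw [← Finset.sum_neg_distrib]
    refine (Equiv.sum_comp (Equiv.addRight e) _).symm.trans (Finset.sum_congr rfl fun x _ => ?_)
    simp only [Equiv.coe_addRight, map_add, h, sgn_add, sgn_one, add_add_self_of_zmod_two]
    ring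
  have h3 : ∑ x, hadamard l e u x ^ 2 = ∑ x, u x ^ 2 + ∑ x, u (x + e) ^ 2 +
      2 * ∑ x, sgn (l x) * u x * u (x + e) := by
    rw [Finset.mul_sum, ← Finset.sum_add_distrib, ← Finset.sum_add_distrib]
    refine Finset.sum_congr rfl fun x _ => ?_
    rw [hadamard]
    linear_combination u x ^ 2 * sgn_sq (l x)
  lia

namespace Extraspecial

noncomputable instance : Fintype (Module.Dual (ZMod 2) V) :=
  have : Finite (Module.Dual (ZMod 2) V) := Module.finite_of_finite (ZMod 2)
  Fintype.ofFinite _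

noncomputable instance : Fintype (Extraspecial V) := Fintype.ofEquiv _ equivProd.symm

theorem card_dual : Fintype.card (Module.Dual (ZMod 2) V) = 2 ^ Module.finrank (ZMod 2) V := by
  rw [Module.card_eq_pow_finrank (K := ZMod 2), Subspace.dual_finrank_eq, ZMod.card]

theorem card_eq : Fintype.card (Extraspecial V) = 2 ^ (2 * Module.finrank (ZMod 2) V + 1) := by
  rw [Fintype.card_congr equivProd, Fintype.card_prod, Fintype.card_prod, card_dual,
    Module.card_eq_pow_finrank (K := ZMod 2) (V := V), ZMod.card]
  ring

instance (k : ℕ) : MulAction (Extraspecial V) (shell V k) where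
  smul g u := ⟨fun x => sgn (g.s + g.b x) * u.1 (x + g.a),
    sgn_mul_mem_shell g.b g.s (translate_mem_shell g.a u.2)⟩
  one_smul u := by
    ext x
    change sgn (0 + (0 : Module.Dual (ZMod 2) V) x) * u.1 (x + 0) = u.1 x
    simp
  mul_smul g h u := by
    ext x
    change sgn (g.s + h.s + h.b g.a + (g.b + h.b) x) * u.1 (x + (g.a + h.a)) =
      sgn (g.s + g.b x) * (sgn (h.s + h.b (x + g.a)) * u.1 (x + g.a + h.a))
    simp only [map_add, LinearMap.add_apply, sgn_add, add_assoc]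
    ring

end Extraspecial

/-- The number of vectors of norm `k` fixed by the element `(s, a, b)`. -/
noncomputable def fixedCount (V : Type*) [AddCommGroup V] [Module (ZMod 2) V] [Fintype V] (k : ℕ)
    (s : ZMod 2) (a : V) (b : Module.Dual (ZMod 2) V) : ℕ :=
  Nat.card {u : V → ℤ // u ∈ shell V k ∧ ∀ x, sgn (s + b x) * u (x + a) = u x}

/-- Burnside's lemma, the quotient being the number of orbits. -/
theorem dvd_sum_fixedCount (k : ℕ) :
    2 ^ (2 * Module.finrank (ZMod 2) V + 1) ∣
      ∑ s, ∑ a, ∑ b, fixedCount V k s a b := by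
  classical
  have : Fintype (shell V k) := Fintype.ofFinite _
  have h := MulAction.sum_card_fixedBy_eq_card_orbits_mul_card_group (Extraspecial V) (shell V k)
  rw [Extraspecial.card_eq] at h
  have h2 : ∑ g : Extraspecial V, Fintype.card (MulAction.fixedBy (shell V k) g) =
      ∑ s, ∑ a, ∑ b, fixedCount V k s a b := by
    rw [← Extraspecial.equivProd.symm.sum_comp, Fintype.sum_prod_type]
    refine Finset.sum_congr rfl fun s _ => ?_
    rw [Fintype.sum_prod_type]
    refine Finset.sum_congr rfl fun a _ => Finset.sum_congr rfl fun b _ => ?_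
    rw [← Nat.card_eq_fintype_card, fixedCount]
    refine Nat.card_congr ((Equiv.subtypeEquivRight fun u => ?_).trans
      (Equiv.subtypeSubtypeEquivSubtypeInter (· ∈ shell V k) _))
    rw [MulAction.mem_fixedBy, Subtype.ext_iff, funext_iff]
    rfl
  rw [← h2, h]
  exact Dvd.intro_left _ rfl

/-! ### Fixed vectors of the elements of the extraspecial group -/

theorem fixedCount_eq_zero {k : ℕ} (hk : k ≠ 0) {s : ZMod 2} {a : V} {b : Module.Dual (ZMod 2) V}
    (h : b a = 1) : fixedCount V k s a b = 0 := by
  refine Nat.card_eq_zero.2 (Or.inl ⟨fun u => ne_zero_of_mem_shell hk u.2.1 ?_⟩)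
  ext x
  have h1 := u.2.2 x
  have h2 := u.2.2 (x + a)
  rw [add_add_self_of_zmod_two, map_add, h, ← add_assoc, sgn_add, sgn_one] at h2
  have h3 := sgn_sq (s + b x)
  have : u.1 x = -u.1 x := by
    linear_combination -h1 - sgn (s + b x) * h2 - u.1 x * h3
  simp only [Pi.zero_apply]
  lia

theorem fixedCount_neg_one {k : ℕ} (hk : k ≠ 0) : fixedCount V k 1 0 0 = 0 := by
  refine Nat.card_eq_zero.2 (Or.inl ⟨fun u => ne_zero_of_mem_shell hk u.2.1 ?_⟩)
  ext x
  have h1 := u.2.2 x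
  simp at h1 ⊢
  lia

theorem fixedCount_one (k : ℕ) : fixedCount V k 0 0 0 = Nat.card (shell V k) :=
  Nat.card_congr (Equiv.subtypeEquivRight fun u => by simp)

theorem card_shell_congr {j k : ℕ} {P : (U → ℤ) → Prop} {Q : (V → ℤ) → Prop}
    (T : (U → ℤ) → (V → ℤ)) (T' : (V → ℤ) → (U → ℤ))
    (h : ∀ u ∈ shell U j, P u → T u ∈ shell V k ∧ Q (T u) ∧ T' (T u) = u)
    (h' : ∀ v ∈ shell V k, Q v → T' v ∈ shell U j ∧ P (T' v) ∧ T (T' v) = v) :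
    Nat.card {u // u ∈ shell U j ∧ P u} = Nat.card {v // v ∈ shell V k ∧ Q v} :=
  Nat.card_congr
    { toFun u := ⟨T u.1, (h _ u.2.1 u.2.2).1, (h _ u.2.1 u.2.2).2.1⟩
      invFun v := ⟨T' v.1, (h' _ v.2.1 v.2.2).1, (h' _ v.2.1 v.2.2).2.1⟩
      left_inv u := Subtype.ext (h _ u.2.1 u.2.2).2.2
      right_inv v := Subtype.ext (h' _ v.2.1 v.2.2).2.2 }

/-- With `l a = 1` and `b a = 0`, the phase `l (b + s)` changes by `b + s` under translation by `a`;
multiplying by its sign therefore conjugates `(s, a, b)` to `(0, a, 0)`. -/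
theorem fixedCount_eq_periodic {k : ℕ} {s : ZMod 2} {a : V} (ha : a ≠ 0)
    {b : Module.Dual (ZMod 2) V} (h : b a = 0) :
    fixedCount V k s a b = fixedCount V k 0 a 0 := by
  obtain ⟨l, hl⟩ := Module.Projective.exists_dual_eq_one (ZMod 2) ha
  let T (u : V → ℤ) (x : V) : ℤ := sgn (l x * (b x + s)) * u x
  have hTT (u : V → ℤ) : T (T u) = u := by
    ext x
    simp only [T, ← mul_assoc, sgn_mul_self, one_mul]
  have hshift (x : V) : sgn (l (x + a) * (b (x + a) + s)) =
      sgn (l x * (b x + s)) * sgn (s + b x) := by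
    rw [← sgn_add, map_add, map_add, h, hl]
    ring_nf
  refine card_shell_congr T T (fun u hu hP => ⟨sgn_quadratic_mul_mem_shell l b s hu,
    fun x => ?_, hTT u⟩) (fun u hu hP => ⟨sgn_quadratic_mul_mem_shell l b s hu,
    fun x => ?_, hTT u⟩)
  · simp only [T, hshift, LinearMap.zero_apply, add_zero, sgn_zero, one_mul, ← hP x]
    ring
  · have := hP x
    simp only [LinearMap.zero_apply, add_zero, sgn_zero, one_mul] at this
    simp only [T, hshift, this]
    linear_combination sgn (l x * (b x + s)) * u x * sgn_mul_self (s + b x)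

theorem exists_eq_one_of_dual_ne_zero {b : Module.Dual (ZMod 2) V} (hb : b ≠ 0) :
    ∃ e, b e = 1 := by
  by_contra! h
  exact hb (LinearMap.ext fun x => (zmod_two_eq_zero_or_one _).resolve_right (h x))

/-- Translation by `e` with `b e = 1` exchanges the two signs `s`. -/
theorem fixedCount_sign {k : ℕ} {s : ZMod 2} {b : Module.Dual (ZMod 2) V} (hb : b ≠ 0) :
    fixedCount V k s 0 b = fixedCount V k 0 0 b := by
  rcases zmod_two_eq_zero_or_one s with rfl | rfl
  · rfl
  obtain ⟨e, he⟩ := exists_eq_one_of_dual_ne_zero hb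
  let T (u : V → ℤ) (x : V) : ℤ := u (x + e)
  have hTT (u : V → ℤ) : T (T u) = u := by
    ext x
    simp only [T, add_add_self_of_zmod_two]
  refine card_shell_congr T T (fun u hu hP => ⟨translate_mem_shell e hu, fun x => ?_, hTT u⟩)
    (fun u hu hP => ⟨translate_mem_shell e hu, fun x => ?_, hTT u⟩)
  all_goals
    have := hP (x + e)
    simpa [T, he, sgn_add] using this

/-- One `hadamard` doubles the norm and raises the level by 1, so two of them followed by halving
preserve the shell. -/
theorem exists_shell_of_hadamard {k : ℕ} {l m : Module.Dual (ZMod 2) V} {e f : V} (he : l e = 1)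
    (hf : m f = 1) {u : V → ℤ} (hu : u ∈ shell V k) :
    ∃ w ∈ shell V k, hadamard m f (hadamard l e u) = (2 : ℤ) • w := by
  have h := hadamard_mem_bwLattice m f (hadamard_mem_bwLattice l e hu.1)
  rw [add_assoc, one_add_one_eq_two] at h
  obtain ⟨w, hw, huw⟩ := exists_two_smul_of_mem_bwLattice le_rfl h
  refine ⟨w, ⟨hw, ?_⟩, huw⟩
  have h1 := sum_hadamard_sq hf (hadamard l e u)
  rw [sum_hadamard_sq he, hu.2, huw] at h1
  simp only [Pi.smul_apply, smul_eq_mul, mul_pow, ← Finset.mul_sum] at h1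
  lia

/-- `hadamard l e` intertwines the sign change by `l` with translation by `e`. A second factor
`hadamard m f` with `m e = 0` commutes with that translation and only corrects the norm. Finding `m
≠ 0` with `m e = 0` requires dimension at least 2. -/
theorem fixedCount_eq_periodic_of_sign (hV : 2 ≤ Module.finrank (ZMod 2) V) {k : ℕ}
    {l : Module.Dual (ZMod 2) V} {e : V} (he : l e = 1) :
    fixedCount V k 0 0 l = fixedCount V k 0 e 0 := by
  obtain ⟨y, hy⟩ : ∃ y, y ∉ Submodule.span (ZMod 2) {e} := by
    by_contra! h
    have h1 := finrank_span_le_card (R := ZMod 2) ({e} : Set V)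
    rw [(Submodule.eq_top_iff'.2 h), finrank_top] at h1
    simp at h1
    lia
  obtain ⟨m, hm, hm'⟩ := Submodule.exists_dual_map_eq_bot_of_notMem hy inferInstance
  have hme : m e = 0 := by
    have : m e ∈ (Submodule.span (ZMod 2) {e}).map m :=
      Submodule.mem_map_of_mem (Submodule.mem_span_singleton_self e)
    simpa [hm'] using this
  obtain ⟨f, hf⟩ := exists_eq_one_of_dual_ne_zero (b := m) fun h => hm (by simp [h])
  have inv {l m : Module.Dual (ZMod 2) V} {e f : V} (he : l e = 1) (hf : m f = 1) {u w : V → ℤ}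
      (h : hadamard m f (hadamard l e u) = (2 : ℤ) • w) :
      hadamard l e (hadamard m f w) = (2 : ℤ) • u := by
    have h1 := congrArg (fun v => hadamard l e (hadamard m f v)) h
    simp only [hadamard_hadamard hf, hadamard_hadamard he, hadamard_two_smul] at h1
    exact (smul_right_injective _ two_ne_zero h1).symm
  refine card_shell_congr (fun u x => hadamard m f (hadamard l e u) x / 2)
    (fun u x => hadamard l e (hadamard m f u) x / 2) (fun u hu hP => ?_) (fun u hu hP => ?_)
  · obtain ⟨w, hw, h⟩ := exists_shell_of_hadamard he hf hu
    simp only [h, inv he hf h, two_smul_ediv, true_and, hw, and_true]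
    intro x
    have h1 (z : V) : hadamard l e u (z + e) = hadamard l e u z := by
      have h2 := hP z
      have h3 := hP (z + e)
      simp only [zero_add, add_zero] at h2 h3
      rw [hadamard, hadamard, h2, h3, add_add_self_of_zmod_two, add_comm]
    have h2 := congrFun h x
    have h3 := congrFun h (x + e)
    rw [hadamard, h1, map_add, hme, add_zero, add_right_comm, h1] at h3
    rw [hadamard, h3] at h2
    simpa using h2
  · obtain ⟨w, hw, h⟩ := exists_shell_of_hadamard hf he hu
    simp only [h, inv hf he h, two_smul_ediv, true_and, hw, and_true]
    intro x
    have h1 : hadamard m f u (x + e) = hadamard m f u x := by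
      have h2 := hP x
      have h3 := hP (x + f)
      simp only [LinearMap.zero_apply, add_zero, sgn_zero, one_mul] at h2 h3
      rw [hadamard, hadamard, map_add, hme, add_zero, h2, add_right_comm, h3]
    have h2 := congrFun h x
    rw [hadamard, h1] at h2
    simp only [Pi.smul_apply, smul_eq_mul] at h2
    rw [zero_add, add_zero]
    change sgn (l x) * (((2 : ℤ) • w) x / 2) = ((2 : ℤ) • w) x / 2
    rw [congrFun (two_smul_ediv w) x]
    have h3 : (2 : ℤ) * (sgn (l x) * w x) = 2 * w x := by
      linear_combination (1 - sgn (l x)) * h2 + hadamard m f u x * sgn_mul_self (l x)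
    exact mul_left_cancel₀ two_ne_zero h3

/-- Vectors of the Barnes–Wall lattice that are periodic are pulled back from a smaller one. -/
theorem fixedCount_periodic (hUV : Module.finrank (ZMod 2) V = Module.finrank (ZMod 2) U + 1)
    {k : ℕ} {a : V} (ha : a ≠ 0) :
    fixedCount V (2 * k) 0 a 0 = Nat.card (shell U k) ∧ fixedCount V (2 * k + 1) 0 a 0 = 0 := by
  classical
  have hdim := Submodule.finrank_quotient_add_finrank (Submodule.span (ZMod 2) {a})
  rw [finrank_span_singleton ha, hUV, add_left_inj] at hdim
  let E : (V ⧸ Submodule.span (ZMod 2) {a}) ≃ₗ[ZMod 2] U := LinearEquiv.ofFinrankEq _ _ hdim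
  let p : V →ₗ[ZMod 2] U := E.toLinearMap ∘ₗ Submodule.mkQ _
  have hp (x y : V) : p x = p y ↔ x = y ∨ x = y + a := by
    rw [show p x = E (Submodule.Quotient.mk x) from rfl,
      show p y = E (Submodule.Quotient.mk y) from rfl, E.injective.eq_iff,
      Submodule.Quotient.eq, Submodule.mem_span_singleton]
    constructor
    · rintro ⟨c, hc⟩
      rcases zmod_two_eq_zero_or_one c with rfl | rfl
      · left; simpa [eq_comm, sub_eq_zero] using hc
      · right; rw [one_smul] at hc; rw [hc]; abel
    · rintro (rfl | rfl)
      · exact ⟨0, by simp⟩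
      · exact ⟨1, by simp⟩
  obtain ⟨t, ht⟩ := p.exists_rightInverse_of_surjective
    (LinearMap.range_eq_top.2 (E.surjective.comp (Submodule.mkQ_surjective _)))
  have ht (y : U) : p (t y) = y := LinearMap.congr_fun ht y
  -- The fibres of `p` are the pairs `{t y, t y + a}`, which is why norms double.
  have hsum (v : U → ℤ) : ∑ x, v (p x) ^ 2 = 2 * ∑ y, v y ^ 2 := by
    rw [← Finset.sum_fiberwise Finset.univ p, Finset.mul_sum]
    refine Finset.sum_congr rfl fun y _ => ?_
    have : Finset.univ.filter (fun x => p x = y) = {t y, t y + a} := by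
      ext x
      rw [Finset.mem_filter, Finset.mem_insert, Finset.mem_singleton, ← hp, ht]
      simp
    rw [this, Finset.sum_pair (by simpa using ha), ht, (hp (t y + a) (t y)).2 (Or.inr rfl), ht]
    ring
  have hper {u : V → ℤ} (h : ∀ x, u (x + a) = u x) : (u ∘ t) ∘ p = u := by
    ext x
    rcases (hp (t (p x)) x).1 (ht _) with h1 | h1
    · simp [h1]
    · simp [h1, h]
  have hnorm {u : V → ℤ} (h : (u ∘ t) ∘ p = u) : ∑ x, u x ^ 2 = 2 * ∑ y, (u ∘ t) y ^ 2 := by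
    rw [← hsum]
    exact Finset.sum_congr rfl fun x _ => congrArg (· ^ 2) (congrFun h x).symm
  constructor
  · refine (card_shell_congr (Q := fun _ => True) (fun u => u ∘ t) (fun v => v ∘ p)
      (fun u hu hP => ?_) (fun v hv _ => ?_)).trans
      (Nat.card_congr (Equiv.subtypeEquivRight (q := (· ∈ shell U k)) fun u => and_iff_left trivial))
    · have hP : (u ∘ t) ∘ p = u := hper (by simpa using hP)
      refine ⟨⟨comp_mem_bwLattice t (by lia) hu.1, ?_⟩, trivial, hP⟩
      have h1 := hnorm hP
      rw [hu.2] at h1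
      push_cast at h1
      change ∑ y, (u ∘ t) y ^ 2 = _
      lia
    · refine ⟨⟨comp_mem_bwLattice p (by lia) hv.1, ?_⟩, fun x => ?_, ?_⟩
      · have := hsum v
        rw [hv.2] at this
        simpa using this
      · simp [(hp (x + a) x).2 (Or.inr rfl)]
      · ext y; simp [ht]
  · refine Nat.card_eq_zero.2 (Or.inl ⟨fun u => ?_⟩)
    have h1 := hnorm (hper (by simpa using u.2.2))
    rw [u.2.1.2] at h1
    push_cast at h1
    lia

theorem even_fixedCount {k : ℕ} (hk : k ≠ 0) (s : ZMod 2) (a : V) (b : Module.Dual (ZMod 2) V) :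
    2 ∣ fixedCount V k s a b := by
  classical
  let X := {u : V → ℤ // u ∈ shell V k ∧ ∀ x, sgn (s + b x) * u (x + a) = u x}
  have : Finite X := (shell_finite k).subset fun u hu => hu.1
  have : Fintype X := Fintype.ofFinite X
  let T : Function.End X := fun u => ⟨-u.1, neg_mem_shell u.2.1, fun x => by simp [← u.2.2 x]⟩
  have h := Equiv.Perm.card_fixedPoints_modEq (f := T) (p := 2) (n := 1) (by
    funext u
    exact Subtype.ext (neg_neg u.1))
  have h0 : Fintype.card T.fixedPoints = 0 := by
    refine Fintype.card_eq_zero_iff.2 ⟨fun u => ne_zero_of_mem_shell hk u.1.2.1 ?_⟩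
    have := congrArg Subtype.val u.2
    exact self_eq_neg.1 this.symm
  rw [h0] at h
  rw [fixedCount, Nat.card_eq_fintype_card]
  exact (Nat.modEq_zero_iff_dvd).1 h

theorem sum_zmod_two {M : Type*} [AddCommMonoid M] (F : ZMod 2 → M) : ∑ s, F s = F 0 + F 1 :=
  Fin.sum_univ_two F

theorem sum_fixedCount {k c : ℕ} (hk : k ≠ 0) (hc : ∀ a : V, a ≠ 0 → fixedCount V k 0 a 0 = c) :
    ∑ s, ∑ a, ∑ b, fixedCount V k s a b = Nat.card (shell V k) +
      2 * ∑ b with b ≠ 0, fixedCount V k 0 (0 : V) b +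
      (2 ^ Module.finrank (ZMod 2) V - 1) * (2 ^ Module.finrank (ZMod 2) V * c) := by
  classical
  have hb (s : ZMod 2) : ∑ b, fixedCount V k s 0 b = fixedCount V k s 0 0 +
      ∑ b with b ≠ 0, fixedCount V k 0 (0 : V) b := by
    rw [← Finset.add_sum_erase _ _ (Finset.mem_univ (0 : Module.Dual (ZMod 2) V)),
      ← Finset.filter_ne']
    exact congrArg _ (Finset.sum_congr rfl fun b hb => fixedCount_sign (by simpa using hb))
  have ha {a : V} (ha : a ≠ 0) (s : ZMod 2) :
      2 * ∑ b, fixedCount V k s a b = 2 ^ Module.finrank (ZMod 2) V * c := by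
    obtain ⟨l, hl⟩ := Module.Projective.exists_dual_eq_one (ZMod 2) ha
    rw [two_mul]
    -- As `l a = 1`, exactly one of `b` and `b + l` vanishes at `a`, so each pair contributes `c`.
    nth_rw 2 [← Equiv.sum_comp (Equiv.addRight l)]
    rw [← Finset.sum_add_distrib, Finset.sum_congr rfl (g := fun _ => c), Finset.sum_const,
      Finset.card_univ, Extraspecial.card_dual, smul_eq_mul]
    intro b _
    rcases zmod_two_eq_zero_or_one (b a) with h | h
    · rw [fixedCount_eq_periodic ha h, hc a ha, fixedCount_eq_zero hk (by simp [h, hl]), add_zero]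
    · rw [fixedCount_eq_zero hk h, zero_add, Equiv.coe_addRight,
        fixedCount_eq_periodic ha (by simp [h, hl]; rfl), hc a ha]
  rw [Finset.sum_comm, ← Finset.add_sum_erase _ _ (Finset.mem_univ (0 : V)),
    Finset.sum_congr rfl (s₁ := Finset.univ.erase (0 : V))
      (g := fun _ => 2 ^ Module.finrank (ZMod 2) V * c),
    Finset.sum_const, Finset.card_erase_of_mem (Finset.mem_univ _), Finset.card_univ,
    Module.card_eq_pow_finrank (K := ZMod 2) (V := V), ZMod.card, smul_eq_mul, sum_zmod_two, hb, hb,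
    fixedCount_neg_one hk, fixedCount_one]
  · ring
  · intro a h
    have h1 := ha (Finset.ne_of_mem_erase h) 0
    have h2 := ha (Finset.ne_of_mem_erase h) 1
    rw [sum_zmod_two]
    lia

end Shell

/-! ### Integral `2 ^ m`-th roots of power series. -/

section Powers

/-- The Catalan series satisfies `F = 1 + X F²`; substituting `-c h` for `X` gives an integral
solution `g = h F(-c h)`. -/
theorem exists_add_mul_sq_eq (c : ℤ) {h : ℤ⟦X⟧} (hh : PowerSeries.constantCoeff h = 0) :
    ∃ g : ℤ⟦X⟧, PowerSeries.constantCoeff g = 0 ∧ g + PowerSeries.C c * g ^ 2 = h := by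
  let F : ℤ⟦X⟧ := PowerSeries.map (Nat.castRingHom ℤ) PowerSeries.catalanSeries
  have hF : F ^ 2 * PowerSeries.X + 1 = F := by
    have := congrArg (PowerSeries.map (Nat.castRingHom ℤ))
      PowerSeries.catalanSeries_sq_mul_X_add_one
    simpa [F] using this
  have hs : PowerSeries.HasSubst (-(PowerSeries.C c * h)) :=
    PowerSeries.HasSubst.of_constantCoeff_zero' (by simp [hh])
  have hK := congrArg (PowerSeries.substAlgHom hs) hF
  rw [map_add, map_mul, map_pow, map_one, PowerSeries.substAlgHom_X hs] at hK
  refine ⟨h * PowerSeries.substAlgHom hs F, by simp [hh], ?_⟩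
  linear_combination -h * hK

theorem exists_sq_eq_one_add {j : ℕ} {h : ℤ⟦X⟧} (hh : PowerSeries.constantCoeff h = 0) :
    ∃ g : ℤ⟦X⟧, PowerSeries.constantCoeff g = 0 ∧
      (1 + 2 ^ (j + 1) * g) ^ 2 = 1 + 2 ^ (j + 2) * h := by
  obtain ⟨g, hg, hgh⟩ := exists_add_mul_sq_eq (2 ^ j) hh
  refine ⟨g, hg, ?_⟩
  have : (PowerSeries.C (2 ^ j : ℤ) : ℤ⟦X⟧) = 2 ^ j := by simp
  rw [← hgh, this]
  ring

theorem one_add_mem_nthPowers (m : ℕ) {h : ℤ⟦X⟧} (hh : PowerSeries.constantCoeff h = 0) :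
    1 + 2 ^ (m + 1) * h ∈ nthPowers (2 ^ m) := by
  induction m generalizing h with
  | zero => exact ⟨1 + 2 ^ (0 + 1) * h, by simp [hh], by simp⟩
  | succ m ih =>
    obtain ⟨g, hg, hgh⟩ := exists_sq_eq_one_add (j := m) hh
    obtain ⟨f, hf, hfg⟩ := ih hg
    refine ⟨f, hf, ?_⟩
    rw [← hgh, hfg, ← pow_mul, ← pow_succ]

theorem exists_eq_smul_of_congrMod {N : ℤ} {f g : ℤ⟦X⟧} (h : CongrMod N f g) :
    ∃ A : ℤ⟦X⟧, f - g = N • A := by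
  choose a ha using fun k => (h k).symm.dvd
  refine ⟨PowerSeries.mk a, ?_⟩
  ext k
  rw [map_sub, ha, map_zsmul, PowerSeries.coeff_mk, smul_eq_mul]

theorem mem_nthPowers_of_congrMod_one {m : ℕ} {f : ℤ⟦X⟧} (h : CongrMod (2 ^ (m + 1)) f 1)
    (hf : PowerSeries.constantCoeff f = 1) : f ∈ nthPowers (2 ^ m) := by
  obtain ⟨A, hA⟩ := exists_eq_smul_of_congrMod h
  have hA0 : PowerSeries.constantCoeff A = 0 := by
    have := congrArg PowerSeries.constantCoeff hA
    rw [map_sub, hf, map_one, sub_self, map_zsmul, smul_eq_mul] at this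
    exact (mul_eq_zero.1 this.symm).resolve_left (by positivity)
  convert one_add_mem_nthPowers m hA0 using 1
  rw [zsmul_eq_mul] at hA
  push_cast at hA
  linear_combination hA

end Powers

/-! ### Transfer to the Euclidean lattice and the congruences for shell counts. -/

section Theta

/-- The embedding of the integral functions on `V` in Euclidean space. -/
noncomputable def castEuclidean (V : Type*) : (V → ℤ) →ₗ[ℤ] EuclideanSpace ℝ V where
  toFun u := WithLp.toLp 2 fun x => (u x : ℝ)
  map_add' u v := by ext x; simp
  map_smul' c u := by ext x; simp

@[simp] theorem castEuclidean_apply {V : Type*} (u : V → ℤ) (x : V) :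
    castEuclidean V u x = (u x : ℝ) := rfl

theorem castEuclidean_injective (V : Type*) : Function.Injective (castEuclidean V) := fun u v h => by
  ext x
  have := congrArg (fun w : EuclideanSpace ℝ V => w x) h
  simpa using this

theorem castEuclidean_flatIndicator {m : ℕ} (W : Submodule (ZMod 2) (Fin m → ZMod 2))
    (v : Fin m → ZMod 2) (k : ℕ) :
    castEuclidean _ ((2 ^ k : ℤ) • flatIndicator W v) = (2 : ℝ) ^ k • flatVector W v := by
  ext x
  by_cases h : x - v ∈ W <;> simp [flatVector, flatIndicator, h]

theorem barnesWall_eq_map (m : ℕ) :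
    barnesWall m = (bwLattice (Fin m → ZMod 2) m).map (castEuclidean _) := by
  apply le_antisymm
  · refine Submodule.span_le.2 ?_
    rintro _ ⟨⟨W, v⟩, rfl⟩
    exact ⟨_, smul_flatIndicator_mem v (by lia), castEuclidean_flatIndicator W v _⟩
  · rw [bwLattice, Submodule.map_span]
    refine Submodule.span_le.2 ?_
    rintro _ ⟨_, ⟨k, W, v, hk, rfl⟩, rfl⟩
    -- The admissible exponents are exactly those at least `⌊(m - d) / 2⌋`; larger ones give
    -- multiples of the generator.
    obtain ⟨j, rfl⟩ := Nat.exists_eq_add_of_le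
      (show (m - Module.finrank (ZMod 2) W) / 2 ≤ k by lia)
    rw [castEuclidean_flatIndicator, pow_add, mul_comm, mul_smul]
    have := (barnesWall m).smul_mem (2 ^ j : ℤ) (Submodule.subset_span ⟨(W, v), rfl⟩)
    rw [← Int.cast_smul_eq_zsmul ℝ] at this
    simpa using this

/-- The number of vectors of norm `k` in the `m`-th Barnes–Wall lattice. -/
noncomputable def shellCount (m k : ℕ) : ℕ := Nat.card (shell (Fin m → ZMod 2) k)

theorem coeff_thetaSeries_barnesWall (m k : ℕ) :
    PowerSeries.coeff k (thetaSeries (barnesWall m)) = shellCount m k := by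
  rw [thetaSeries, PowerSeries.coeff_mk, shellCount, Nat.cast_inj]
  have hn (u : (Fin m → ZMod 2) → ℤ) :
      inner ℝ (castEuclidean _ u) (castEuclidean _ u) = (k : ℝ) ↔ ∑ x, u x ^ 2 = k := by
    rw [PiLp.inner_apply, ← @Int.cast_inj ℝ]
    simp [sq]
  symm
  refine Nat.card_congr (Equiv.ofBijective (fun u => ⟨castEuclidean _ u.1, ?_, ?_⟩) ⟨?_, ?_⟩)
  · rw [barnesWall_eq_map]
    exact ⟨_, by simpa using u.2.1, rfl⟩
  · exact (hn _).2 u.2.2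
  · intro u v h
    exact Subtype.ext (castEuclidean_injective _ (congrArg Subtype.val h))
  · rintro ⟨u, hu, hk⟩
    rw [barnesWall_eq_map] at hu
    obtain ⟨w, hw, rfl⟩ := hu
    exact ⟨⟨w, by simpa using hw, (hn w).1 hk⟩, rfl⟩

theorem shellCount_zero (m : ℕ) : shellCount m 0 = 1 := by
  refine Nat.card_eq_one_iff_unique.2 ⟨⟨fun u v => ?_⟩, ⟨0, Submodule.zero_mem _, by simp⟩⟩
  have h (w : shell (Fin m → ZMod 2) 0) : w.1 = 0 := by
    ext x
    have := (Finset.sum_eq_zero_iff_of_nonneg fun x _ => sq_nonneg _).1 w.2.2 x (Finset.mem_univ x)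
    simpa using this
  exact Subtype.ext ((h u).trans (h v).symm)

/-- The coefficients of the theta series of the `m`-th Barnes–Wall lattice, scaled by `2`. -/
noncomputable def doubledShellCount (m k : ℕ) : ℕ := if 2 ∣ k then shellCount m (k / 2) else 0

theorem coeff_expand_thetaSeries_barnesWall (m k : ℕ) :
    PowerSeries.coeff k (PowerSeries.expand 2 two_ne_zero (thetaSeries (barnesWall m))) =
      doubledShellCount m k := by
  rw [doubledShellCount]
  split_ifs with h
  · obtain ⟨j, rfl⟩ := h
    rw [PowerSeries.coeff_expand_mul, coeff_thetaSeries_barnesWall,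
      Nat.mul_div_cancel_left _ two_pos]
  · rw [PowerSeries.coeff_expand_of_not_dvd _ _ _ h, Nat.cast_zero]

theorem fixedCount_translate (m k : ℕ) {a : Fin (m + 1) → ZMod 2} (ha : a ≠ 0) :
    fixedCount (Fin (m + 1) → ZMod 2) k 0 a 0 = doubledShellCount m k := by
  have h (j : ℕ) := fixedCount_periodic (U := Fin m → ZMod 2) (by simp) (k := j) ha
  rw [doubledShellCount]
  split_ifs with hk
  · obtain ⟨j, rfl⟩ := hk
    rw [(h j).1, Nat.mul_div_cancel_left _ two_pos, shellCount]
  · obtain ⟨j, rfl⟩ := Nat.not_even_iff_odd.1 (mt Even.two_dvd hk)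
    exact (h j).2

/-- The pure sign changes stay as a separate sum, so that the one-dimensional case, where they are
not equivalent to translations, is covered too. -/
theorem dvd_shellCount_add {m k : ℕ} (hk : k ≠ 0) :
    2 ^ (2 * (m + 1) + 1) ∣ shellCount (m + 1) k +
      2 * ∑ b with b ≠ 0, fixedCount (Fin (m + 1) → ZMod 2) k 0 0 b +
      (2 ^ (m + 1) - 1) * (2 ^ (m + 1) * doubledShellCount m k) := by
  have h := dvd_sum_fixedCount (V := Fin (m + 1) → ZMod 2) k
  rw [sum_fixedCount hk fun a => fixedCount_translate m k] at h
  rw [Module.finrank_fin_fun] at h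
  exact h

theorem shellCount_modEq {m k : ℕ} (hm : 1 ≤ m) (hk : k ≠ 0) :
    (2 ^ (2 * (m + 1) + 1) : ℤ) ∣ shellCount (m + 1) k +
      (2 ^ (m + 1) - 1) * (2 ^ (m + 1) + 2) * doubledShellCount m k := by
  classical
  have h := dvd_shellCount_add (m := m) hk
  have hsum : ∑ b with b ≠ 0, fixedCount (Fin (m + 1) → ZMod 2) k 0 0 b =
      (2 ^ (m + 1) - 1) * doubledShellCount m k := by
    rw [Finset.sum_congr rfl (g := fun _ => doubledShellCount m k), Finset.sum_const,
      Finset.filter_ne', Finset.card_erase_of_mem (Finset.mem_univ _), Finset.card_univ,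
      Extraspecial.card_dual, smul_eq_mul]
    · simp
    · intro b hb
      obtain ⟨e, he⟩ := exists_eq_one_of_dual_ne_zero (by simpa using hb)
      rw [fixedCount_eq_periodic_of_sign (by simpa using hm) he, fixedCount_translate]
      rintro rfl
      simp at he
  rw [hsum] at h
  have h1 := Int.natCast_dvd_natCast.2 h
  push_cast [Nat.cast_sub Nat.one_le_two_pow] at h1
  convert h1 using 1
  ring

theorem dvd_shellCount {m k : ℕ} (hk : k ≠ 0) : 2 ^ (m + 2) ∣ shellCount (m + 1) k := by
  induction m generalizing k with
  -- In dimension 1, evenness of the fixed counts under `u ↦ -u` suffices for divisibility by 4.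
  | zero =>
    have h1 : 2 ∣ ∑ b with b ≠ 0, fixedCount (Fin (0 + 1) → ZMod 2) k 0 0 b :=
      Finset.dvd_sum fun b _ => even_fixedCount hk _ _ _
    have h2 : 2 ∣ doubledShellCount 0 k := by
      rw [← fixedCount_translate 0 k (a := 1) one_ne_zero]
      exact even_fixedCount hk _ _ _
    have h3 := dvd_shellCount_add (m := 0) hk
    norm_num at h3 ⊢
    lia
  | succ m ih =>
    have h1 : 2 ^ (m + 2) ∣ doubledShellCount (m + 1) k := by
      rw [doubledShellCount]
      split_ifs with h
      · exact ih (by lia)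
      · exact dvd_zero _
    have h2 := shellCount_modEq (m := m + 1) (by lia) hk
    zify at h1 ⊢
    obtain ⟨c, hc⟩ := h1
    obtain ⟨d, hd⟩ := h2
    refine ⟨2 ^ (m + 2) * d - (2 ^ (m + 2) - 1) * (2 ^ (m + 1) + 1) * c, ?_⟩
    rw [hc] at hd
    linear_combination hd

theorem dvd_doubledShellCount {m k : ℕ} (hk : k ≠ 0) :
    2 ^ (m + 2) ∣ doubledShellCount (m + 1) k := by
  rw [doubledShellCount]
  split_ifs with h
  · exact dvd_shellCount (by lia)
  · exact dvd_zero _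

theorem congrMod_one_of_dvd {N : ℕ} {f : ℤ⟦X⟧} {c : ℕ → ℕ}
    (hf : ∀ k, PowerSeries.coeff k f = c k) (h0 : c 0 = 1) (hc : ∀ k, k ≠ 0 → N ∣ c k) :
    CongrMod N f 1 := by
  intro k
  rw [hf, PowerSeries.coeff_one]
  split_ifs with hk
  · rw [hk, h0]; rfl
  · exact (Int.modEq_zero_iff_dvd).2 (Int.natCast_dvd_natCast.2 (hc k hk))

theorem congrMod_thetaSeries_barnesWall (m : ℕ) :
    CongrMod (2 ^ (m + 2)) (thetaSeries (barnesWall (m + 1))) 1 := by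
  have := congrMod_one_of_dvd (N := 2 ^ (m + 2)) (coeff_thetaSeries_barnesWall (m + 1))
    (shellCount_zero _) fun k hk => dvd_shellCount hk
  exact_mod_cast this

theorem congrMod_expand_thetaSeries_barnesWall (m : ℕ) :
    CongrMod (2 ^ (m + 2))
      (PowerSeries.expand 2 two_ne_zero (thetaSeries (barnesWall (m + 1)))) 1 := by
  have := congrMod_one_of_dvd (N := 2 ^ (m + 2)) (coeff_expand_thetaSeries_barnesWall (m + 1))
    (by simp [doubledShellCount, shellCount_zero]) fun k hk => dvd_doubledShellCount hk
  exact_mod_cast this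

end Theta

theorem mainTheorem8 :
    (∀ m : ℕ, 1 ≤ m →
      CongrMod (2 ^ (m + 1)) (thetaSeries (barnesWall m)) 1 ∧
      thetaSeries (barnesWall m) ∈ nthPowers (2 ^ m)) ∧
    (∀ m : ℕ, 2 ≤ m →
      ∃ A B : PowerSeries ℤ,
        thetaSeries (barnesWall m) - 1 = (2 ^ (m + 1) : ℤ) • A ∧
        PowerSeries.expand 2 two_ne_zero (thetaSeries (barnesWall (m - 1))) - 1 =
          (2 ^ m : ℤ) • B ∧
        CongrMod (2 ^ m) A ((1 - 2 ^ (m - 1) : ℤ) • B)) := by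
  refine ⟨fun m hm => ?_, fun m hm => ?_⟩
  · obtain ⟨m, rfl⟩ := Nat.exists_eq_add_of_le' hm
    have h := congrMod_thetaSeries_barnesWall m
    refine ⟨h, mem_nthPowers_of_congrMod_one h ?_⟩
    rw [← PowerSeries.coeff_zero_eq_constantCoeff_apply, coeff_thetaSeries_barnesWall,
      shellCount_zero, Nat.cast_one]
  · obtain ⟨m, rfl⟩ := Nat.exists_eq_add_of_le' hm
    obtain ⟨A, hA⟩ := exists_eq_smul_of_congrMod (congrMod_thetaSeries_barnesWall (m + 1))
    obtain ⟨B, hB⟩ := exists_eq_smul_of_congrMod (congrMod_expand_thetaSeries_barnesWall m)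
    refine ⟨A, B, hA, hB, fun k => ?_⟩
    have hAk := congrArg (PowerSeries.coeff k) hA
    have hBk := congrArg (PowerSeries.coeff k) hB
    rw [map_sub, map_zsmul, smul_eq_mul, PowerSeries.coeff_one] at hAk hBk
    rw [coeff_thetaSeries_barnesWall] at hAk
    rw [coeff_expand_thetaSeries_barnesWall] at hBk
    rw [map_zsmul, smul_eq_mul, show m + 2 - 1 = m + 1 by lia]
    generalize PowerSeries.coeff k A = a, PowerSeries.coeff k B = b at *
    have h2 : (2 : ℤ) ^ (m + 2) ≠ 0 := by positivity
    obtain rfl | hk := eq_or_ne k 0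
    · have ha : a = 0 := by
        simpa [shellCount_zero] using hAk
      have hb : b = 0 := by
        simpa [doubledShellCount, shellCount_zero] using hBk
      rw [ha, hb, mul_zero]
    · obtain ⟨d, hd⟩ := shellCount_modEq (m := m + 1) (by lia) hk
      rw [if_neg hk, sub_zero] at hAk hBk
      rw [hAk, hBk] at hd
      -- After cancelling `2 ^ (m+3)`, `hd` reads `a + (2^(m+2) - 1)(2^(m+1) + 1) b = 2^(m+2) d`.
      -- The coefficient of `b` equals `2^(2m+3) - (1 - 2^(m+1))`, whence the witness.
      refine (Int.modEq_iff_dvd.2 ⟨d - 2 ^ (m + 1) * b, ?_⟩).symm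
      refine mul_left_cancel₀ (mul_ne_zero two_ne_zero h2) ?_
      linear_combination hd
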